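/- Let $K\in\mathbb{C}$ and $n\ge 4$, and put $H^K(a,b,c)=-a^2-b^2-c^2+2ab+2ac+2bc-Kabc$. A \emph{spherical Heronian diamond} is a tuple $(a,b,c,d,e,f,p,q,r,s)$ of complex numbers with $p^2=H^K(b,c,e)$, $q^2=H^K(a,d,e)$, $r^2=H^K(a,b,f)$, $s^2=H^K(c,d,f)$, $p+q=r+s+\frac K2(ap+bq-er)$, $4ef(1-\frac{Ke}4)=(p+q)^2+(a-b+c-d)^2-Ke(a-b)(c-d)$ and $e(r-s)=p(a-d)+q(b-c)$. Let $I_n$ consist of the points $(i,j)$, $(i+\frac12,j)$, $(i,j+\frac12)$ ($i,j\in\mathbb{Z}$) whose coordinates $(x,y)$ satisfy $0\le y-x\le n$, and of the lines $(i+\frac12,\diagup)$ and $(\diagdown,j+\frac12)$ ($i,j\in\mathbb{Z}$). A \emph{spherical Heronian frieze of order $n$} is an array $\mathbf z=(z_\alpha)_{\alpha\in I_n}$ of complex numbers such that for all integers $i,j$ with $1\le j-i\le n-1$ the tuple $$(z_{(i,j+1)},z_{(i+\frac12,\diagup)},z_{(i+1,j)},z_{(\diagdown,j+\frac12)},z_{(i,j)},z_{(i+1,j+1)},z_{(i+\frac12,j)},z_{(i,j+\frac12)},z_{(i+\frac12,j+1)},z_{(i+1,j+\frac12)})$$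 is a spherical Heronian diamond, and such that $z_\alpha=0$ at all points $\alpha=(x,y)\in I_n$ with $y-x\in\{0,\frac12,n-\frac12,n\}$. A \emph{traversing path} $\pi$ consists of $2n-3$ points of $I_n$, leading from a point $(k,k+1)$ to a point $(m,m+n-1)$ ($k,m\in\mathbb{Z}$), where each step either raises the second coordinate by $\frac12$ or lowers the first coordinate by $\frac12$, together with the $n-2$ lines that it crosses: $(\diagdown,j+\frac12)$ at a point $(i,j+\frac12)$ of $\pi$, and $(i+\frac12,\diagup)$ at a point $(i+\frac12,j)$ of $\pi$. Let $\mathbf z_\pi$ be the tuple of the $3n-5$ entries of $\mathbf z$ on $\pi$, write $x_{ij}=z_{(i,j)}$, and let $D(\pi)$ be the set of the elements $x_{ij}\left(1-\frac{Kx_{ij}}4\right)$ for the integer points $(i,j)$ of $\pi$ with $2\le j-i\le n-2$. For $K=1/R^2$ with $R\in\mathbb{C}\setminus\{0\}$, let $\mathbf S=\{A\in\mathbb{C}^3:\langle A,A\rangle=R^2\}$, where $\langle\cdot,\cdot\rangle$ is the standard symmetric bilinear form. An $n$-tuple of points $A_m\in\mathbf S$, indexed by $m\in\mathbb{Z}/n$,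 gives a spherical Heronian frieze $\mathbf z$ with $z_{(i,j)}=x(A_i,A_j)$, $z_{(i+\frac12,j)}=S^K(A_i,A_{i+1},A_j)$, $z_{(i,j+\frac12)}=S^K(A_i,A_j,A_{j+1})$, $z_{(i+\frac12,\diagup)}=x(A_i,A_{i+1})$, $z_{(\diagdown,j+\frac12)}=x(A_j,A_{j+1})$, where $x(A,B)=\langle B-A,B-A\rangle$ and $S^K(A,B,C)=\frac2R\det[A\;B\;C]$. Such a frieze is said to arise from a spherical polygon. \textbf{Proposition (Laurent phenomenon).} For every traversing path $\pi$ and every $\alpha\in I_n$ there is a rational function, of the form (polynomial in $\mathbf z_\pi$ with complex coefficients) divided by (monomial in the elements of $D(\pi)$), depending only on $K$, $n$, $\pi$ and $\alpha$, whose value at $\mathbf z_\pi$ is $z_\alpha$ for every spherical Heronian frieze $\mathbf z$ of order $n$ such that all elements of $D(\pi)$ are nonzero and such that, moreover, $\mathbf z$ arises from a spherical polygon or satisfies $z_{(i,j)}\notin\{0,\frac4K\}$ (only $z_{(i,j)}\neq0$ if $K=0$) for all integers $i,j$ with $2\le j-i\le n-2$. -/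

import Mathlib

namespace SphericalFrieze

/-- The Heron polynomial `H^K(a, b, c)`. -/
def heronPoly (K a b c : ℂ) : ℂ :=
  -a ^ 2 - b ^ 2 - c ^ 2 + 2 * a * b + 2 * a * c + 2 * b * c - K * a * b * c

/-- The 10-tuple `(a, b, c, d, e, f, p, q, r, s)` is a spherical Heronian diamond. -/
structure IsHeronianDiamond (K a b c d e f p q r s : ℂ) : Prop where
  heron_p : p ^ 2 = heronPoly K b c e
  heron_q : q ^ 2 = heronPoly K a d e
  heron_r : r ^ 2 = heronPoly K a b f
  heron_s : s ^ 2 = heronPoly K c d f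
  sum_eq : p + q = r + s + K / 2 * (a * p + b * q - e * r)
  bretschneider : 4 * e * f * (1 - K * e / 4) =
    (p + q) ^ 2 + (a - b + c - d) ^ 2 - K * e * (a - b) * (c - d)
  diff_eq : e * (r - s) = p * (a - d) + q * (b - c)

/-- Names for the possible locations in a frieze, for integers `i`, `j`:
* `node i j` is the point `(i, j)`;
* `halfFst i j` is the point `(i + 1/2, j)`;
* `halfSnd i j` is the point `(i, j + 1/2)`;
* `lineNE i` is the line heading Northeast whose points have first coordinate `i + 1/2`;
* `lineSE j` is the line heading Southeast whose points have second coordinate `j + 1/2`. -/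
inductive FriezeIndex : Type
  | node (i j : ℤ) : FriezeIndex
  | halfFst (i j : ℤ) : FriezeIndex
  | halfSnd (i j : ℤ) : FriezeIndex
  | lineNE (i : ℤ) : FriezeIndex
  | lineSE (j : ℤ) : FriezeIndex

/-- The index set `I_n`: all lines, and those points whose coordinates `(x, y)` satisfy
`0 ≤ y - x ≤ n`. -/
def indexSet (n : ℕ) : Set FriezeIndex := fun α =>
  match α with
  | .node i j => i ≤ j ∧ j ≤ i + n
  | .halfFst i j => i + 1 ≤ j ∧ j ≤ i + n
  | .halfSnd i j => i ≤ j ∧ j + 1 ≤ i + n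
  | .lineNE _ => True
  | .lineSE _ => True

/-- `z` is a spherical Heronian frieze of order `n` (for the parameter `K`). Only the values of `z`
on `indexSet n` are constrained; the other values carry no meaning and are never used. -/
structure IsFrieze (K : ℂ) (n : ℕ) (z : FriezeIndex → ℂ) : Prop where
  diamond : ∀ i j : ℤ, 1 ≤ j - i → j - i ≤ n - 1 →
    IsHeronianDiamond K
      (z (.node i (j + 1))) (z (.lineNE i)) (z (.node (i + 1) j)) (z (.lineSE j))
      (z (.node i j)) (z (.node (i + 1) (j + 1)))
      (z (.halfFst i j)) (z (.halfSnd i j)) (z (.halfFst i (j + 1))) (z (.halfSnd (i + 1) j))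
  bottom_node : ∀ i : ℤ, z (.node i i) = 0
  top_node : ∀ i : ℤ, z (.node i (i + n)) = 0
  bottom_halfSnd : ∀ i : ℤ, z (.halfSnd i i) = 0
  bottom_halfFst : ∀ i : ℤ, z (.halfFst i (i + 1)) = 0
  top_halfSnd : ∀ i : ℤ, z (.halfSnd i (i + n - 1)) = 0
  top_halfFst : ∀ i : ℤ, z (.halfFst i (i + n)) = 0

/-- No entry `z_(i,j)` with `2 ≤ j - i ≤ n - 2` lies in `{0, 4/K}` (in `{0}` when `K = 0`). -/
def NonVanishing (K : ℂ) (n : ℕ) (z : FriezeIndex → ℂ) : Prop :=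
  ∀ i j : ℤ, 2 ≤ j - i → j - i ≤ n - 2 → z (.node i j) ≠ 0 ∧ K * z (.node i j) ≠ 4

/-! ### Spherical polygons and their friezes -/

/-- The measurement `x(A, B) = ⟨B - A, B - A⟩` for the bilinear scalar product on `ℂ³`. -/
def sqDist (A B : Fin 3 → ℂ) : ℂ := (B - A) ⬝ᵥ (B - A)

/-- The measurement `S^K(A, B, C) = (12 / R) V`, where `V = det[A B C] / 6` is the signed volume
of the tetrahedron `OABC`. -/
noncomputable def triS (R : ℂ) (A B C : Fin 3 → ℂ) : ℂ :=
  12 / R * (1 / 6 * Matrix.det !![A 0, B 0, C 0; A 1, B 1, C 1; A 2, B 2, C 2])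

/-- The array attached to the polygon with vertices `P m`, labelled cyclically by `m : ZMod n`. -/
noncomputable def polygonFrieze (n : ℕ) (R : ℂ) (P : ZMod n → Fin 3 → ℂ) : FriezeIndex → ℂ
  | .node i j => sqDist (P i) (P j)
  | .halfFst i j => triS R (P i) (P (i + 1 : ℤ)) (P j)
  | .halfSnd i j => triS R (P i) (P j) (P (j + 1 : ℤ))
  | .lineNE i => sqDist (P i) (P (i + 1 : ℤ))
  | .lineSE j => sqDist (P j) (P (j + 1 : ℤ))

/-- On the index set `I_n`, the array `z` is the array of a polygon on the sphere
`⟨A, A⟩ = R²` in `ℂ³`, where `K = 1 / R²`. -/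
def ArisesFromPolygon (K : ℂ) (n : ℕ) (z : FriezeIndex → ℂ) : Prop :=
  ∃ (R : ℂ) (P : ZMod n → Fin 3 → ℂ), R ≠ 0 ∧ K = 1 / R ^ 2 ∧ (∀ m, P m ⬝ᵥ P m = R ^ 2) ∧
    ∀ α ∈ indexSet n, z α = polygonFrieze n R P α

/-! ### Traversing paths -/

/-- A traversing path in a frieze of order `n`, given by its integer nodes
`(fst 0, snd 0), …, (fst (n - 2), snd (n - 2))` in their order (the values of `fst` and `snd`
past `n - 2` are not used). The path starts at a point `(k, k + 1)`, and each move from an integer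
node to the next one goes one unit up: from `(i, j)` either through `(i, j + 1/2)` to `(i, j + 1)`,
or through `(i - 1/2, j)` to `(i - 1, j)`. By `snd_sub_fst` it ends at a point `(m, m + n - 1)`. -/
structure TraversingPath (n : ℕ) where
  fst : ℕ → ℤ
  snd : ℕ → ℤ
  start : snd 0 = fst 0 + 1
  step : ∀ t : ℕ, t + 2 < n →
    (fst (t + 1) = fst t ∧ snd (t + 1) = snd t + 1) ∨
    (fst (t + 1) = fst t - 1 ∧ snd (t + 1) = snd t)

namespace TraversingPath

variable {n : ℕ}

theorem snd_sub_fst (π : TraversingPath n) (t : ℕ) (ht : t + 1 < n) :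
    π.snd t = π.fst t + t + 1 := by
  induction t with
  | zero => simpa using π.start
  | succ t ih =>
    have h := ih (by omega)
    rcases π.step t (by omega) with ⟨h1, h2⟩ | ⟨h1, h2⟩ <;> push_cast <;> omega

/-- The half-integer point of `π` between its integer nodes number `t` and `t + 1`. -/
def half (π : TraversingPath n) (t : ℕ) : FriezeIndex :=
  if π.fst (t + 1) = π.fst t then .halfSnd (π.fst t) (π.snd t)
  else .halfFst (π.fst (t + 1)) (π.snd t)

/-- The line that crosses `π` perpendicularly at the half-integer point `π.half t`. -/
def line (π : TraversingPath n) (t : ℕ) : FriezeIndex :=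
  if π.fst (t + 1) = π.fst t then .lineSE (π.snd t)
  else .lineNE (π.fst (t + 1))

/-- The `3 * n - 5` positions on a traversing path: `n - 1` integer nodes, `n - 2` half-integer
points and `n - 2` lines. -/
abbrev Pos (n : ℕ) : Type := Fin (n - 1) ⊕ Fin (n - 2) ⊕ Fin (n - 2)

/-- The index in `I_n` at a position of `π`. -/
def index (π : TraversingPath n) : Pos n → FriezeIndex
  | .inl t => .node (π.fst t) (π.snd t)
  | .inr (.inl t) => π.half t
  | .inr (.inr t) => π.line t

/-- The initial data `z_π`. -/
def initialData (π : TraversingPath n) (z : FriezeIndex → ℂ) : Pos n → ℂ := fun u => z (π.index u)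

/-- The (numbers of the) integer nodes `(i, j)` of `π` with `2 ≤ j - i ≤ n - 2`. -/
def diagonals (π : TraversingPath n) : Finset (Fin (n - 1)) :=
  Finset.univ.filter fun t => 2 ≤ π.snd t - π.fst t ∧ π.snd t - π.fst t ≤ (n : ℤ) - 2

/-- The element `x (1 - K x / 4)` of `D(π)`, where `x` is the entry at the integer node number
`t` of `π`. -/
noncomputable def denomFactor (π : TraversingPath n) (K : ℂ) (z : FriezeIndex → ℂ)
    (t : Fin (n - 1)) : ℂ :=
  π.initialData z (.inl t) * (1 - K * π.initialData z (.inl t) / 4)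

end TraversingPath

end SphericalFrieze

/-!
The proof replaces friezes by polygons. The surface `u² + v² + K t² = 2 t` is a copy of the sphere
of curvature `K` when `K ≠ 0`, and a copy of the plane when `K = 0`, so that both cases are treated
at once. Any four of its points satisfy the relations of a Heronian diamond; those used, besides
Heron's formula, are `QPoint.area_add_area`, `QPoint.dist_mul_area_sub_area` and
`QPoint.bretschneider`. The latter are linear in the three measurements on the far side of a diagonal,
with determinant a multiple of `x (1 - K x / 4)`, where `x` is the entry at the diagonal.

Laurent phenomenon for polygons (`measure_mem_laurentAlgebra`). Let a point be described relative to
a diagonal of the path by its distances from the two endpoints and by the triangle it spans with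
them. Passing to the next or to the previous diagonal of the path changes this description by
polynomials in the initial data and in the inverse of `x (1 - K x / 4)` for the old diagonal only.
Each vertex of the polygon is an endpoint of some node of the path, where its description is part of
the initial data; hence all vertices can be described relative to one fixed diagonal of the path,
and the same relations then give the distance of any two vertices and the measurement of any three.
No diagonal off the path is ever inverted.

Friezes without vanishing entries (`exists_polygon_measure_eq`). The row of a frieze with first
coordinate `k` holds the data of the fan of triangles at the vertex `k`, which can be realized by
points of the surface, one triangle after the other: the next point solves linear equations, and
Heron's formula puts it on the surface. The diamonds then force the frieze to agree with the
measurements of this polygon in the rows `k`, `k + 1`, and so on. With `k` to the left of the path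
and of the index `α`, this is all that is needed, so no polygon for the whole frieze has to be
constructed.
-/

namespace SphericalFrieze

/-! ### A model of the sphere that is uniform in the curvature -/

/-- A point of the surface `u² + v² + K t² = 2 t`. For `K = 1 / R²` this is the sphere of radius `R`
with the origin moved to one of its points and the third coordinate rescaled; for `K = 0` it is a
paraboloid over the Euclidean plane with coordinates `(u, v)`. -/
structure QPoint (K : ℂ) where
  u : ℂ
  v : ℂ
  t : ℂ
  mem : u ^ 2 + v ^ 2 + K * t ^ 2 = 2 * t

namespace QPoint

variable {K : ℂ}

/-- The squared distance `(u - u')² + (v - v')² + K (t - t')²` of two points, made affine in each of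
them by means of the equation of the surface. -/
def dist (A B : QPoint K) : ℂ := 2 * (A.t + B.t - A.u * B.u - A.v * B.v - K * A.t * B.t)

/-- The measurement of an oriented triangle: twice the determinant with rows `(u, v, 1 - K t)`. -/
def area (A B C : QPoint K) : ℂ :=
  2 * (A.u * (B.v * (1 - K * C.t) - (1 - K * B.t) * C.v)
    - A.v * (B.u * (1 - K * C.t) - (1 - K * B.t) * C.u)
    + (1 - K * A.t) * (B.u * C.v - B.v * C.u))

theorem dist_self (A : QPoint K) : dist A A = 0 := by
  unfold dist; linear_combination (-2) * A.mem

theorem dist_comm (A B : QPoint K) : dist A B = dist B A := by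
  unfold dist; ring

theorem area_rotate (A B C : QPoint K) : area B C A = area A B C := by
  unfold area; ring

theorem area_swap (A B C : QPoint K) : area A C B = -area A B C := by
  unfold area; ring

theorem area_swap_left (A B C : QPoint K) : area B A C = -area A B C := by
  unfold area; ring

theorem area_self_right (A B : QPoint K) : area A B B = 0 := by
  unfold area; ring

theorem area_self_outer (A B : QPoint K) : area A B A = 0 := by
  unfold area; ring

theorem area_self (A B : QPoint K) : area A A B = 0 := by
  unfold area; ring

/-- Cramer's rule for the four vectors `(u, v, 1 - K t)`, paired with the first of them. -/
theorem area_add_area (A B C D : QPoint K) :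
    area A B C + area A C D = area A B D + area B C D
      + K / 2 * (dist A D * area A B C + dist A B * area A C D - dist A C * area A B D) := by
  linear_combination (norm := (unfold dist area; ring1)) (K * area B C D) * A.mem

/-- Cramer's rule for the four vectors `(u, v, 1 - K t)`, paired with the linear form
`dist A X - dist C X` in the vector of `X`. -/
theorem dist_mul_area_sub_area (A B C D : QPoint K) :
    dist A C * (area A B D - area B C D) =
      area A B C * (dist A D - dist C D) + area A C D * (dist A B - dist B C) := by
  linear_combination (norm := (unfold dist area; ring1))
    (2 * area B C D) * A.mem - (2 * area A B D) * C.mem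

/-- The quadratic form `x² + y² + K z²` of a displacement `(x, y, z)`, expressed through its
products with the vectors of two points of the surface and with their cross product. -/
theorem quadratic_form_eq {a₁ a₂ a₃ c₁ c₂ c₃ e : ℂ} (x y z : ℂ)
    (ha : a₁ ^ 2 + a₂ ^ 2 + K * a₃ ^ 2 = 2 * a₃) (hc : c₁ ^ 2 + c₂ ^ 2 + K * c₃ ^ 2 = 2 * c₃)
    (he : e = 2 * (a₃ + c₃ - a₁ * c₁ - a₂ * c₂ - K * a₃ * c₃)) :
    e * (4 - K * e) * (x ^ 2 + y ^ 2 + K * z ^ 2) =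
      (2 * ((a₂ * (1 - K * c₃) - (1 - K * a₃) * c₂) * x
        - (a₁ * (1 - K * c₃) - (1 - K * a₃) * c₁) * y - (a₁ * c₂ - a₂ * c₁) * K * z)) ^ 2
      + (2 * (z - a₁ * x - a₂ * y - K * a₃ * z) - 2 * (z - c₁ * x - c₂ * y - K * c₃ * z)) ^ 2
      + K * e * (2 * (z - a₁ * x - a₂ * y - K * a₃ * z))
        * (2 * (z - c₁ * x - c₂ * y - K * c₃ * z)) := by
  have ha' : a₁ ^ 2 = 2 * a₃ - a₂ ^ 2 - K * a₃ ^ 2 := by linear_combination ha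
  have hc' : c₁ ^ 2 = 2 * c₃ - c₂ ^ 2 - K * c₃ ^ 2 := by linear_combination hc
  clear ha hc
  subst he
  grind

/-- The Bretschneider formula for a quadrilateral on the surface. -/
theorem bretschneider (A B C D : QPoint K) :
    4 * dist A C * dist B D * (1 - K * dist A C / 4) = (area A B C + area A C D) ^ 2
      + (dist A D - dist A B + dist B C - dist C D) ^ 2
      - K * dist A C * (dist A D - dist A B) * (dist B C - dist C D) := by
  have h := quadratic_form_eq (K := K) (D.u - B.u) (D.v - B.v) (D.t - B.t) A.mem C.mem
    (e := dist A C) rfl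
  have hBD : (D.u - B.u) ^ 2 + (D.v - B.v) ^ 2 + K * (D.t - B.t) ^ 2 = dist B D := by
    unfold dist; linear_combination B.mem + D.mem
  have hpq : 2 * ((A.v * (1 - K * C.t) - (1 - K * A.t) * C.v) * (D.u - B.u)
        - (A.u * (1 - K * C.t) - (1 - K * A.t) * C.u) * (D.v - B.v)
        - (A.u * C.v - A.v * C.u) * K * (D.t - B.t)) = area A B C + area A C D := by
    unfold area; ring
  have hA : 2 * (D.t - B.t - A.u * (D.u - B.u) - A.v * (D.v - B.v) - K * A.t * (D.t - B.t))
      = dist A D - dist A B := by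
    unfold dist; ring
  have hC : 2 * (D.t - B.t - C.u * (D.u - B.u) - C.v * (D.v - B.v) - K * C.t * (D.t - B.t))
      = dist C D - dist B C := by
    unfold dist; ring
  rw [hBD, hpq, hA, hC] at h
  linear_combination h

/-- In a Heronian diamond whose data at one diagonal `e ∉ {0, 4 / K}` are measured from four points
of the surface, the remaining data are measured from these points, too: they are determined by the
equations of the diamond, which the four points satisfy. -/
theorem eq_of_isHeronianDiamond (A B C D : QPoint K) {f r s : ℂ}
    (h : IsHeronianDiamond K (dist A D) (dist A B) (dist B C) (dist C D) (dist A C) f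
      (area A B C) (area A C D) r s)
    (h0 : dist A C ≠ 0) (h4 : K * dist A C ≠ 4) :
    f = dist B D ∧ r = area A B D ∧ s = area B C D := by
  have h4' : 4 - K * dist A C ≠ 0 := sub_ne_zero.mpr h4.symm
  have h1 := area_add_area A B C D
  have h2 := dist_mul_area_sub_area A B C D
  have h3 := bretschneider A B C D
  have h5 := h.sum_eq
  have h6 := h.diff_eq
  have hr : r = area A B D := by
    apply mul_left_cancel₀ (mul_ne_zero h0 h4')
    linear_combination 2 * (h6 - h2 + dist A C * (h1 - h5))
  refine ⟨?_, hr, ?_⟩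
  · apply mul_left_cancel₀ (mul_ne_zero h0 h4')
    linear_combination h.bretschneider - h3
  · subst hr
    linear_combination h1 - h5

end QPoint

open QPoint TraversingPath

/-! ### Polygons and their measurements -/

/-- The array of measurements of a polygon in the model surface. -/
def measure {K : ℂ} (P : ℤ → QPoint K) : FriezeIndex → ℂ
  | .node i j => dist (P i) (P j)
  | .halfFst i j => area (P i) (P (i + 1)) (P j)
  | .halfSnd i j => area (P i) (P j) (P (j + 1))
  | .lineNE i => dist (P i) (P (i + 1))
  | .lineSE j => dist (P j) (P (j + 1))

/-! ### Algebras of measurements -/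

section Frame

variable {X : Type*} {K : ℂ} (S : Subalgebra ℂ (X → ℂ))

/-- The position of `C` relative to `A` and `B`, given by its distances from `A` and `B` and by the
measurement of the triangle `ABC`, is expressed by functions in the algebra `S`. Here `A`, `B`, `C`
are points of the surface that depend on a parameter in `X`. -/
structure Frame (A B C : X → QPoint K) : Prop where
  left : (fun x => dist (A x) (C x)) ∈ S
  right : (fun x => dist (B x) (C x)) ∈ S
  tri : (fun x => area (A x) (B x) (C x)) ∈ S

/-- The segment `AB` is measured in `S`, and its discriminant `x (1 - K x / 4)` is a unit of `S`. -/
structure Nondegenerate (A B : X → QPoint K) : Prop where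
  mem : (fun x => dist (A x) (B x)) ∈ S
  inv : (fun x => (dist (A x) (B x) * (1 - K * dist (A x) (B x) / 4))⁻¹) ∈ S
  ne_zero : ∀ x, dist (A x) (B x) * (1 - K * dist (A x) (B x) / 4) ≠ 0

variable {S} {A B C D : X → QPoint K}

theorem dist_comm_mem (h : (fun x => dist (A x) (B x)) ∈ S) :
    (fun x => dist (B x) (A x)) ∈ S := by
  simpa only [QPoint.dist_comm] using h

theorem area_swap_mem (h : (fun x => area (A x) (B x) (C x)) ∈ S) :
    (fun x => area (B x) (A x) (C x)) ∈ S := by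
  convert S.neg_mem h using 2 with x
  exact area_swap_left _ _ _

theorem Frame.swap (h : Frame S A B C) : Frame S B A C :=
  ⟨h.right, h.left, area_swap_mem h.tri⟩

theorem Frame.endpoint_left (h : (fun x => dist (A x) (B x)) ∈ S) : Frame S A B A := by
  refine ⟨?_, dist_comm_mem h, ?_⟩
  · convert S.zero_mem using 2 with x
    exact QPoint.dist_self _
  · convert S.zero_mem using 2 with x
    exact area_self_outer _ _

theorem Frame.endpoint_right (h : (fun x => dist (A x) (B x)) ∈ S) : Frame S A B B :=
  (Frame.endpoint_left (dist_comm_mem h)).swap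

theorem Nondegenerate.swap (h : Nondegenerate S A B) : Nondegenerate S B A := by
  obtain ⟨h1, h2, h3⟩ := h
  refine ⟨dist_comm_mem h1, ?_, fun x => ?_⟩
  · simpa only [QPoint.dist_comm] using h2
  · simpa only [QPoint.dist_comm] using h3 x

theorem Nondegenerate.dist_mem (h : Nondegenerate S A B) (hC : Frame S A B C)
    (hD : Frame S A B D) : (fun x => dist (C x) (D x)) ∈ S := by
  obtain ⟨h1, h2, h3⟩ := h
  obtain ⟨c1, c2, c3⟩ := hC
  obtain ⟨d1, d2, d3⟩ := hD
  have key : (fun x => dist (C x) (D x)) = (4⁻¹ : ℂ) •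
      ((((fun x => area (A x) (B x) (D x)) - fun x => area (A x) (B x) (C x)) ^ 2
      + ((fun x => dist (A x) (D x)) - (fun x => dist (A x) (C x))
        + (fun x => dist (B x) (C x)) - fun x => dist (B x) (D x)) ^ 2
      - K • ((fun x => dist (A x) (B x)) * ((fun x => dist (A x) (D x)) - fun x => dist (A x) (C x))
        * ((fun x => dist (B x) (C x)) - fun x => dist (B x) (D x))))
      * fun x => (dist (A x) (B x) * (1 - K * dist (A x) (B x) / 4))⁻¹) := by
    funext x
    have hx := h3 x
    have := bretschneider (A x) (C x) (B x) (D x)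
    rw [area_swap (A x) (B x) (C x), QPoint.dist_comm (C x) (B x)] at this
    simp only [Pi.smul_apply, Pi.mul_apply, Pi.add_apply, Pi.sub_apply, Pi.pow_apply, smul_eq_mul]
    rw [← mul_assoc, ← div_eq_mul_inv, eq_div_iff hx]
    linear_combination this / 4
  rw [key]
  exact S.smul_mem (S.mul_mem (S.sub_mem (S.add_mem (S.pow_mem (S.sub_mem d3 c3) 2)
    (S.pow_mem (S.sub_mem (S.add_mem (S.sub_mem d1 c1) c2) d2) 2))
    (S.smul_mem (S.mul_mem (S.mul_mem h1 (S.sub_mem d1 c1)) (S.sub_mem c2 d2)) _)) h2) _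

theorem Nondegenerate.area_mem (h : Nondegenerate S A B) (hC : Frame S A B C)
    (hD : Frame S A B D) : (fun x => area (A x) (C x) (D x)) ∈ S := by
  obtain ⟨h1, h2, h3⟩ := h
  obtain ⟨c1, c2, c3⟩ := hC
  obtain ⟨d1, d2, d3⟩ := hD
  have key : (fun x => area (A x) (C x) (D x)) = (2⁻¹ : ℂ) •
      (((fun x => area (A x) (B x) (D x)) * ((fun x => dist (A x) (C x)) - fun x => dist (B x) (C x))
        - (fun x => area (A x) (B x) (C x))
          * ((fun x => dist (A x) (D x)) - fun x => dist (B x) (D x))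
        + (fun x => dist (A x) (B x)) * ((fun x => area (A x) (B x) (D x))
          - (fun x => area (A x) (B x) (C x)) - (K / 2) •
            ((fun x => dist (A x) (C x)) * (fun x => area (A x) (B x) (D x))
              - (fun x => dist (A x) (D x)) * fun x => area (A x) (B x) (C x))))
      * fun x => (dist (A x) (B x) * (1 - K * dist (A x) (B x) / 4))⁻¹) := by
    funext x
    have hx := h3 x
    have e1 := area_add_area (A x) (C x) (B x) (D x)
    have e2 := dist_mul_area_sub_area (A x) (C x) (B x) (D x)
    rw [area_swap (A x) (B x) (C x)] at e1 e2
    rw [QPoint.dist_comm (C x) (B x)] at e2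
    simp only [Pi.smul_apply, Pi.mul_apply, Pi.add_apply, Pi.sub_apply, smul_eq_mul]
    rw [← mul_assoc, ← div_eq_mul_inv, eq_div_iff hx]
    linear_combination (e2 - dist (A x) (B x) * e1) / 2
  rw [key]
  exact S.smul_mem (S.mul_mem (S.add_mem (S.sub_mem (S.mul_mem d3 (S.sub_mem c1 c2))
    (S.mul_mem c3 (S.sub_mem d1 d2))) (S.mul_mem h1 (S.sub_mem (S.sub_mem d3 c3)
    (S.smul_mem (S.sub_mem (S.mul_mem c1 d3) (S.mul_mem d1 c3)) _)))) h2) _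

/-- A nondegenerate frame `AB` can be replaced by `AC`, where `C` is a point known relative
to `AB`. -/
theorem Nondegenerate.change (h : Nondegenerate S A B) (hC : Frame S A B C)
    (hD : Frame S A B D) : Frame S A C D :=
  ⟨hD.left, h.dist_mem hC hD, h.area_mem hC hD⟩

/-- The identity `area_add_area` expresses an arbitrary triangle by triangles with vertex `A`. -/
theorem Nondegenerate.area_mem_of_frame {E : X → QPoint K} (h : Nondegenerate S A B)
    (hC : Frame S A B C) (hD : Frame S A B D) (hE : Frame S A B E) :
    (fun x => area (C x) (D x) (E x)) ∈ S := by
  have p := h.area_mem hC hD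
  have q := h.area_mem hD hE
  have r := h.area_mem hC hE
  have key : (fun x => area (C x) (D x) (E x)) = (fun x => area (A x) (C x) (D x))
      + (fun x => area (A x) (D x) (E x)) - (fun x => area (A x) (C x) (E x))
      - (K / 2) • ((fun x => dist (A x) (E x)) * (fun x => area (A x) (C x) (D x))
        + (fun x => dist (A x) (C x)) * (fun x => area (A x) (D x) (E x))
        - (fun x => dist (A x) (D x)) * fun x => area (A x) (C x) (E x)) := by
    funext x
    simp only [Pi.smul_apply, Pi.mul_apply, Pi.add_apply, Pi.sub_apply, smul_eq_mul]
    linear_combination -area_add_area (A x) (C x) (D x) (E x)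
  rw [key]
  exact S.sub_mem (S.sub_mem (S.add_mem p q) r) (S.smul_mem (S.sub_mem (S.add_mem
    (S.mul_mem hE.left p) (S.mul_mem hC.left q)) (S.mul_mem hD.left r)) _)

end Frame

/-! ### The Laurent phenomenon for polygons -/

section Laurent

variable {K : ℂ} {n : ℕ}

/-- The polygons with `n` vertices on the model surface, labelled `n`-periodically by integers, for
which all elements of `D(π)` are nonzero. -/
abbrev GenericPolygon (K : ℂ) (π : TraversingPath n) : Type :=
  {P : ℤ → QPoint K // (∀ i, P (i + n) = P i) ∧
    ∀ t ∈ π.diagonals, π.denomFactor K (measure P) t ≠ 0}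

/-- The functions of a generic polygon generated by the initial data on `π` and by the inverses of
the elements of `D(π)`. -/
def laurentAlgebra (K : ℂ) (π : TraversingPath n) : Subalgebra ℂ (GenericPolygon K π → ℂ) :=
  Algebra.adjoin ℂ ((Set.range fun u P => π.initialData (measure P.1) u) ∪
    (fun t P => (π.denomFactor K (measure P.1) t)⁻¹) '' (π.diagonals : Set (Fin (n - 1))))

theorem exists_eval_div_of_mem_laurentAlgebra (π : TraversingPath n) {F : GenericPolygon K π → ℂ}
    (hF : F ∈ laurentAlgebra K π) :
    ∃ (N : MvPolynomial (Pos n) ℂ) (m : Fin (n - 1) → ℕ), ∀ P : GenericPolygon K π,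
      F P = MvPolynomial.eval (π.initialData (measure P.1)) N /
        ∏ t ∈ π.diagonals, π.denomFactor K (measure P.1) t ^ m t := by
  -- The elements of `D(π)` as polynomials in the initial data.
  let d : Fin (n - 1) → MvPolynomial (Pos n) ℂ := fun t =>
    MvPolynomial.X (.inl t) * (1 - MvPolynomial.C (K / 4) * MvPolynomial.X (.inl t))
  have hd : ∀ (P : GenericPolygon K π) t,
      MvPolynomial.eval (π.initialData (measure P.1)) (d t) =
        π.denomFactor K (measure P.1) t := by
    intro P t
    simp only [d, map_mul, map_sub, map_one, MvPolynomial.eval_X, MvPolynomial.eval_C,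
      denomFactor]
    ring
  have hne : ∀ (P : GenericPolygon K π) (m : Fin (n - 1) → ℕ),
      ∏ t ∈ π.diagonals, π.denomFactor K (measure P.1) t ^ m t ≠ 0 := fun P m =>
    Finset.prod_ne_zero_iff.mpr fun t ht => pow_ne_zero _ (P.2.2 t ht)
  induction hF using Algebra.adjoin_induction with
  | mem F hF =>
    rcases hF with ⟨u, rfl⟩ | ⟨t, ht, rfl⟩
    · exact ⟨MvPolynomial.X u, 0, fun P => by simp⟩
    · refine ⟨1, Pi.single t 1, fun P => ?_⟩
      rw [Finset.prod_eq_single_of_mem t ht]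
      · simp
      · intro s _ hs
        simp [Pi.single_eq_of_ne hs]
  | algebraMap c => exact ⟨MvPolynomial.C c, 0, fun P => by simp⟩
  | add F G _ _ hF hG =>
    obtain ⟨N, m, h⟩ := hF
    obtain ⟨N', m', h'⟩ := hG
    refine ⟨N * ∏ t ∈ π.diagonals, d t ^ m' t + N' * ∏ t ∈ π.diagonals, d t ^ m t, m + m',
      fun P => ?_⟩
    simp only [Pi.add_apply, h P, h' P, map_add, map_mul, map_prod, map_pow, hd, pow_add,
      Finset.prod_mul_distrib]
    rw [div_add_div _ _ (hne P m) (hne P m')]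
    ring
  | mul F G _ _ hF hG =>
    obtain ⟨N, m, h⟩ := hF
    obtain ⟨N', m', h'⟩ := hG
    refine ⟨N * N', m + m', fun P => ?_⟩
    simp only [Pi.mul_apply, h P, h' P, Pi.add_apply, map_mul, pow_add,
      Finset.prod_mul_distrib, div_mul_div_comm]

/-- The vertex with label `i`, as a function of the polygon. -/
def vertex (π : TraversingPath n) (i : ℤ) : GenericPolygon K π → QPoint K := fun P => P.1 i

variable (K) (π : TraversingPath n)

/-- The frame of the vertex `i` with respect to the diagonal at the node number `t` of the path. -/
abbrev NodeFrame (t : ℕ) (i : ℤ) : Prop :=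
  Frame (laurentAlgebra K π) (vertex π (π.fst t)) (vertex π (π.snd t)) (vertex π i)

theorem initialData_mem (u : Pos n) :
    (fun P : GenericPolygon K π => π.initialData (measure P.1) u) ∈ laurentAlgebra K π :=
  Algebra.subset_adjoin (Or.inl ⟨u, rfl⟩)

theorem node_mem {t : ℕ} (ht : t + 1 < n) :
    (fun P => dist (vertex π (π.fst t) P) (vertex π (π.snd t) P)) ∈ laurentAlgebra K π :=
  initialData_mem K π (.inl ⟨t, by omega⟩)

theorem nondegenerate_of_node {t : ℕ} (h1 : 1 ≤ t) (ht : t + 2 < n) :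
    Nondegenerate (laurentAlgebra K π) (vertex π (π.fst t)) (vertex π (π.snd t)) := by
  have hmem : (⟨t, by omega⟩ : Fin (n - 1)) ∈ π.diagonals := by
    have := π.snd_sub_fst t (by omega)
    simp only [diagonals, Finset.mem_filter, Finset.mem_univ, true_and]
    omega
  have hd : ∀ P : GenericPolygon K π, π.denomFactor K (measure P.1) ⟨t, by omega⟩ =
      dist (vertex π (π.fst t) P) (vertex π (π.snd t) P)
        * (1 - K * dist (vertex π (π.fst t) P) (vertex π (π.snd t) P) / 4) := fun _ => rfl
  refine ⟨node_mem K π (by omega), ?_, fun P => hd P ▸ P.2.2 _ hmem⟩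
  simp only [← hd]
  exact Algebra.subset_adjoin (Or.inr (Set.mem_image_of_mem _ hmem))

/-- The triangle between two consecutive nodes of the path is part of the initial data. -/
theorem nodeFrame_triangle {t : ℕ} (ht : t + 2 < n) :
    (NodeFrame K π t (π.fst (t + 1)) ∧ NodeFrame K π t (π.snd (t + 1))) ∧
      NodeFrame K π (t + 1) (π.fst t) ∧ NodeFrame K π (t + 1) (π.snd t) := by
  have e := node_mem K π (t := t) (by omega)
  have e' := node_mem K π (t := t + 1) (by omega)
  have hh := initialData_mem K π (.inr (.inl ⟨t, by omega⟩))
  have hl := initialData_mem K π (.inr (.inr ⟨t, by omega⟩))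
  simp only [initialData, index, half, line] at hh hl
  unfold NodeFrame
  rcases π.step t ht with ⟨h1, h2⟩ | ⟨h1, h2⟩
  · rw [if_pos h1] at hh hl
    rw [h1, h2] at e' ⊢
    refine ⟨⟨.endpoint_left e, ⟨e', hl, hh⟩⟩, .endpoint_left e', ⟨e, dist_comm_mem hl, ?_⟩⟩
    convert (laurentAlgebra K π).neg_mem hh using 2 with P
    exact area_swap _ _ _
  · rw [if_neg (by omega)] at hh hl
    have h3 : π.fst t = π.fst (t + 1) + 1 := by omega
    rw [h2] at e' ⊢
    simp only [measure, ← h3] at hh hl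
    refine ⟨⟨⟨dist_comm_mem hl, dist_comm_mem e', ?_⟩, .endpoint_right e⟩,
      ⟨hl, dist_comm_mem e, ?_⟩, .endpoint_right e'⟩
    · convert hh using 2 with P
      exact area_rotate _ _ _
    · convert (laurentAlgebra K π).neg_mem hh using 2 with P
      exact area_swap _ _ _

/-- Frames can be transported along the path in both directions. -/
theorem nodeFrame_succ_iff {t : ℕ} (h1 : 1 ≤ t) (ht : t + 3 < n) (i : ℤ) :
    NodeFrame K π (t + 1) i ↔ NodeFrame K π t i := by
  have hN := nondegenerate_of_node K π h1 (by omega)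
  have hN' := nondegenerate_of_node K π (t := t + 1) (by omega) (by omega)
  obtain ⟨⟨a1, a2⟩, a3, a4⟩ := nodeFrame_triangle K π (t := t) (by omega)
  unfold NodeFrame at *
  rcases π.step t (by omega) with ⟨e1, e2⟩ | ⟨e1, e2⟩
  · rw [e1] at hN' a3 a4 ⊢
    exact ⟨fun h => hN'.change a4 h, fun h => hN.change a2 h⟩
  · rw [e2] at hN' a3 a4 ⊢
    exact ⟨fun h => (hN'.swap.change a3.swap h.swap).swap,
      fun h => (hN.swap.change a1.swap h.swap).swap⟩

theorem nodeFrame_one_of_nodeFrame {t : ℕ} (h1 : 1 ≤ t) (ht : t + 2 < n) {i : ℤ}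
    (h : NodeFrame K π t i) : NodeFrame K π 1 i := by
  induction t, h1 using Nat.le_induction with
  | base => exact h
  | succ t h1 ih => exact ih (by omega) ((nodeFrame_succ_iff K π h1 (by omega) i).mp h)

/-- The nodes of a traversing path involve all labels of the polygon. -/
theorem exists_eq_fst_or_eq_snd {t : ℕ} (ht : t + 1 < n) {i : ℤ} (h1 : π.fst t ≤ i)
    (h2 : i ≤ π.snd t) : ∃ s ≤ t, i = π.fst s ∨ i = π.snd s := by
  induction t with
  | zero =>
    have := π.start
    exact ⟨0, le_rfl, by omega⟩
  | succ t ih =>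
    by_cases hi : i = π.fst (t + 1) ∨ i = π.snd (t + 1)
    · exact ⟨t + 1, le_rfl, hi⟩
    · obtain ⟨s, hs, h⟩ := ih (by omega)
        (by rcases π.step t (by omega) with ⟨_, _⟩ | ⟨_, _⟩ <;> omega)
        (by rcases π.step t (by omega) with ⟨_, _⟩ | ⟨_, _⟩ <;> omega)
      exact ⟨s, by omega, h⟩

theorem nodeFrame_one (hn : 4 ≤ n) (i : ℤ) : NodeFrame K π 1 i := by
  have key : ∀ j, π.fst (n - 2) ≤ j → j ≤ π.snd (n - 2) → NodeFrame K π 1 j := by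
    intro j h1 h2
    obtain ⟨s, hs, hj⟩ := exists_eq_fst_or_eq_snd π (by omega) h1 h2
    rcases Nat.eq_zero_or_pos s with rfl | hs0
    · obtain ⟨-, a3, a4⟩ := nodeFrame_triangle K π (t := 0) (by omega)
      rcases hj with rfl | rfl <;> assumption
    · rcases Nat.lt_or_ge (s + 2) n with hsn | hsn
      · have e := node_mem K π (t := s) (by omega)
        refine nodeFrame_one_of_nodeFrame K π hs0 hsn ?_
        rcases hj with rfl | rfl
        · exact .endpoint_left e
        · exact .endpoint_right e
      · obtain ⟨⟨a1, a2⟩, -⟩ := nodeFrame_triangle K π (t := n - 3) (by omega)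
        obtain rfl : s = n - 3 + 1 := by omega
        refine nodeFrame_one_of_nodeFrame K π (t := n - 3) (by omega) (by omega) ?_
        rcases hj with rfl | rfl <;> assumption
  -- Reduce `i` modulo `n` to a label between the endpoints of the last node of the path.
  have hper : ∀ k : ℤ, vertex (K := K) π i = vertex π (i - n * k) := by
    intro k
    funext P
    have := Function.Periodic.sub_int_mul_eq (f := P.1) (c := (n : ℤ)) P.2.1 k (x := i)
    simpa [vertex, mul_comm] using this.symm
  have hs := π.snd_sub_fst (n - 2) (by omega)
  have hn0 : (0 : ℤ) < n := by omega
  have hm1 := Int.emod_nonneg (i - π.fst (n - 2)) hn0.ne'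
  have hm2 := Int.emod_lt_of_pos (i - π.fst (n - 2)) hn0
  have hm3 := Int.emod_add_mul_ediv (i - π.fst (n - 2)) n
  unfold NodeFrame
  rw [hper ((i - π.fst (n - 2)) / n)]
  apply key <;> omega

theorem measure_mem_laurentAlgebra (hn : 4 ≤ n) (α : FriezeIndex) :
    (fun P : GenericPolygon K π => measure P.1 α) ∈ laurentAlgebra K π := by
  have hN := nondegenerate_of_node K π (t := 1) le_rfl (by omega)
  have hF := nodeFrame_one K π hn
  cases α with
  | node i j => exact hN.dist_mem (hF i) (hF j)
  | halfFst i j => exact hN.area_mem_of_frame (hF i) (hF (i + 1)) (hF j)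
  | halfSnd i j => exact hN.area_mem_of_frame (hF i) (hF j) (hF (j + 1))
  | lineNE i => exact hN.dist_mem (hF i) (hF (i + 1))
  | lineSE j => exact hN.dist_mem (hF j) (hF (j + 1))

end Laurent

/-! ### Boundary relations in a frieze -/

section Boundary

variable {K : ℂ} {n : ℕ} {z : FriezeIndex → ℂ}

namespace IsFrieze

theorem node_succ (hz : IsFrieze K n z) (hn : 2 ≤ n) (i : ℤ) :
    z (.node i (i + 1)) = z (.lineNE i) ∧ z (.node (i + 1) (i + 1 + 1)) = z (.lineSE (i + 1)) ∧
      z (.halfFst i (i + 1 + 1)) = z (.halfSnd i (i + 1)) := by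
  have hd := hz.diamond i (i + 1) (by omega) (by omega)
  have h1 := hz.bottom_node (i + 1)
  have h2 := hz.bottom_halfFst i
  have h3 := hz.bottom_halfSnd (i + 1)
  obtain ⟨hp, -, -, hs, hsum, -, hdiff⟩ := hd
  rw [h1] at hp hs hdiff
  rw [h2] at hp hsum hdiff
  rw [h3] at hs hsum hdiff
  unfold heronPoly at hp hs
  have e1 : z (.node i (i + 1)) = z (.lineNE i) :=
    sub_eq_zero.mp (pow_eq_zero_iff two_ne_zero |>.mp (by linear_combination hp))
  have e2 : z (.node (i + 1) (i + 1 + 1)) = z (.lineSE (i + 1)) :=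
    sub_eq_zero.mp (pow_eq_zero_iff two_ne_zero |>.mp (by linear_combination hs))
  refine ⟨e1, e2, ?_⟩
  rw [e1] at hsum hdiff
  linear_combination K / 2 * hdiff - hsum

theorem lineNE_eq (hz : IsFrieze K n z) (hn : 2 ≤ n) (i : ℤ) : z (.lineNE i) = z (.lineSE i) := by
  have h1 := (hz.node_succ hn i).1
  have h2 := (hz.node_succ hn (i - 1)).2.1
  rw [sub_add_cancel] at h2
  exact h1.symm.trans h2

theorem node_top (hz : IsFrieze K n z) (hn : 2 ≤ n) (i : ℤ) :
    z (.node i (i + n - 1)) = z (.lineSE (i + n - 1)) ∧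
      z (.node (i + 1) (i + n)) = z (.lineNE i) ∧
      z (.halfSnd (i + 1) (i + n - 1)) = z (.halfFst i (i + n - 1)) := by
  have hd := hz.diamond i (i + n - 1) (by omega) (by omega)
  rw [sub_add_cancel] at hd
  have h1 := hz.top_node i
  have h2 := hz.top_halfFst i
  have h3 := hz.top_halfSnd i
  obtain ⟨-, hq, hr, -, hsum, -, -⟩ := hd
  rw [h1] at hq hr hsum
  rw [h2] at hr hsum
  rw [h3] at hq hsum
  unfold heronPoly at hq hr
  refine ⟨sub_eq_zero.mp (pow_eq_zero_iff two_ne_zero |>.mp (by linear_combination hq)),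
    sub_eq_zero.mp (pow_eq_zero_iff two_ne_zero |>.mp (by linear_combination hr)), ?_⟩
  linear_combination -hsum

theorem lineSE_add (hz : IsFrieze K n z) (hn : 2 ≤ n) (i : ℤ) :
    z (.lineSE (i + n)) = z (.lineSE i) := by
  have h1 := (hz.node_top hn i).2.1
  have h2 := (hz.node_top hn (i + 1)).1
  rw [show i + 1 + (n : ℤ) - 1 = i + n by ring] at h2
  rw [← h2, h1, hz.lineNE_eq hn]

end IsFrieze

end Boundary

/-! ### Realizing a fan of triangles by a polygon -/

section Fan

variable {K : ℂ} {n : ℕ} {z : FriezeIndex → ℂ}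

/-- The origin of the model surface. -/
def origin (K : ℂ) : QPoint K := ⟨0, 0, 0, by ring⟩

theorem dist_origin (B : QPoint K) : dist (origin K) B = 2 * B.t := by
  simp [QPoint.dist, origin]

theorem area_origin (B C : QPoint K) :
    area (origin K) B C = 2 * (B.u * C.v - B.v * C.u) := by
  simp [area, origin]

/-- A triangle with given measurements can be attached to the segment from the origin to `B`:
its third vertex solves linear equations, and lies on the surface by Heron's formula. -/
theorem exists_third_point {a d e q : ℂ} (hq : q ^ 2 = heronPoly K a d e) {B : QPoint K}
    (hB : dist (origin K) B = e) (h0 : e ≠ 0) (h4 : K * e ≠ 4) :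
    ∃ C : QPoint K, dist (origin K) C = a ∧ dist B C = d ∧ area (origin K) B C = q := by
  rw [dist_origin] at hB
  obtain ⟨u, v, t, hm⟩ := B
  simp only at hB
  subst hB
  unfold heronPoly at hq
  have hε : u ^ 2 + v ^ 2 ≠ 0 := by
    have : u ^ 2 + v ^ 2 = (2 * t) * (4 - K * (2 * t)) / 4 := by linear_combination hm
    rw [this]
    exact div_ne_zero (mul_ne_zero h0 (sub_ne_zero.mpr h4.symm)) (by norm_num)
  -- The product `u u' + v v'` for the new point `(u', v', a / 2)`.
  obtain ⟨m, hm'⟩ : ∃ m, m = t + a / 2 - K * t * (a / 2) - d / 2 := ⟨_, rfl⟩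
  refine ⟨⟨(u * m - v * (q / 2)) / (u ^ 2 + v ^ 2), (v * m + u * (q / 2)) / (u ^ 2 + v ^ 2),
    a / 2, ?_⟩, ?_, ?_, ?_⟩
  · have : m ^ 2 + q ^ 2 / 4 = (u ^ 2 + v ^ 2) * (a - K * (a / 2) ^ 2) := by
      rw [hq, hm']
      linear_combination (-(a - K * (a / 2) ^ 2)) * hm
    field_simp
    linear_combination (u ^ 2 + v ^ 2) * 4 * this
  · rw [dist_origin]; ring
  · simp only [QPoint.dist]
    field_simp
    rw [hm']
    ring
  · rw [area_origin]
    field_simp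
    ring

theorem exists_dist_origin (K e : ℂ) : ∃ B : QPoint K, dist (origin K) B = e := by
  obtain ⟨u, hu⟩ := IsAlgClosed.exists_pow_nat_eq (2 * (e / 2) - K * (e / 2) ^ 2) two_pos
  refine ⟨⟨u, 0, e / 2, by rw [hu]; ring⟩, ?_⟩
  rw [dist_origin]; ring

/-- A frieze contains the measurements of the fan of triangles at any vertex `k`, and under the
nonvanishing condition this fan can be built one triangle after the other. -/
theorem exists_fan (hz : IsFrieze K n z) (hn : 4 ≤ n) (hv : NonVanishing K n z) (k : ℤ) :
    ∃ V : ℕ → QPoint K,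
      (∀ s : ℕ, s < n → dist (V 0) (V s) = z (.node k (k + s))) ∧
      (∀ s : ℕ, s + 1 < n → area (V 0) (V s) (V (s + 1)) = z (.halfSnd k (k + s))) ∧
      (∀ s : ℕ, s + 1 < n → dist (V s) (V (s + 1)) = z (.lineSE (k + s))) := by
  have heron : ∀ s : ℕ, 1 ≤ s → s + 1 ≤ n → z (.halfSnd k (k + s)) ^ 2 =
      heronPoly K (z (.node k (k + (s + 1 : ℕ)))) (z (.lineSE (k + s))) (z (.node k (k + s))) := by
    intro s h1 h2
    have := (hz.diamond k (k + s) (by omega) (by omega)).heron_q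
    rwa [show k + (s : ℤ) + 1 = k + (s + 1 : ℕ) by push_cast; ring] at this
  have hv' : ∀ s : ℕ, 2 ≤ s → s + 2 ≤ n →
      z (.node k (k + s)) ≠ 0 ∧ K * z (.node k (k + s)) ≠ 4 := fun s h1 h2 =>
    hv k (k + s) (by omega) (by omega)
  obtain ⟨B, hB⟩ := exists_dist_origin K (z (.node k (k + (2 : ℕ))))
  have h2 := hv' 2 le_rfl hn
  -- The vertex before the diagonal from `k` to `k + 2`.
  obtain ⟨A, hA1, hA2, hA3⟩ := exists_third_point (K := K) (B := B)
    (a := z (.node k (k + (1 : ℕ)))) (d := z (.lineSE (k + (1 : ℕ))))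
    (q := -z (.halfSnd k (k + (1 : ℕ))))
    (by rw [neg_sq, heron 1 le_rfl (by omega)]; unfold heronPoly; ring) hB h2.1 h2.2
  have next : ∀ (s : ℕ) (B : QPoint K), ∃ C : QPoint K, s + 4 ≤ n →
      dist (origin K) B = z (.node k (k + (s + 2 : ℕ))) →
        dist (origin K) C = z (.node k (k + (s + 3 : ℕ))) ∧
        dist B C = z (.lineSE (k + (s + 2 : ℕ))) ∧
        area (origin K) B C = z (.halfSnd k (k + (s + 2 : ℕ))) := by
    intro s B
    by_cases h : s + 4 ≤ n ∧ dist (origin K) B = z (.node k (k + (s + 2 : ℕ)))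
    · have h3 := hv' (s + 2) (by omega) (by omega)
      obtain ⟨C, hC⟩ := exists_third_point (heron (s + 2) (by omega) (by omega)) h.2 h3.1 h3.2
      exact ⟨C, fun _ _ => hC⟩
    · exact ⟨B, fun h3 h4 => absurd ⟨h3, h4⟩ h⟩
  choose f hf using next
  let Q : ℕ → QPoint K := fun s => Nat.rec B (fun s C => f s C) s
  have hQ : ∀ s, s + 3 ≤ n → dist (origin K) (Q s) = z (.node k (k + (s + 2 : ℕ))) := by
    intro s
    induction s with
    | zero => exact fun _ => hB
    | succ s ih => exact fun h => (hf s (Q s) (by omega) (ih (by omega))).1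
  let V : ℕ → QPoint K
    | 0 => origin K
    | 1 => A
    | s + 2 => Q s
  refine ⟨V, ?_, ?_, ?_⟩
  · rintro (_ | _ | s) hs
    · change dist (origin K) (origin K) = _
      rw [QPoint.dist_self, Nat.cast_zero, add_zero, hz.bottom_node]
    · exact hA1
    · exact hQ s (by omega)
  · rintro (_ | _ | s) hs
    · change area (origin K) (origin K) A = _
      rw [area_self, Nat.cast_zero, add_zero, hz.bottom_halfSnd]
    · change area (origin K) A B = _
      rw [area_swap, hA3, neg_neg]
    · exact (hf s (Q s) (by omega) (hQ s (by omega))).2.2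
  · rintro (_ | _ | s) hs
    · change dist (origin K) A = _
      rw [hA1, Nat.cast_zero, add_zero, Nat.cast_one, (hz.node_succ (by omega) k).1,
        hz.lineNE_eq (by omega)]
    · change dist A B = _
      rw [QPoint.dist_comm, hA2]
    · exact (hf s (Q s) (by omega) (hQ s (by omega))).2.1

end Fan

/-! ### Propagation through a frieze -/

section Propagation

variable {K : ℂ} {n : ℕ} {z : FriezeIndex → ℂ}

/-- The nodes of `z` with first coordinate `i`, and the half-integer points between them, are
measured from the polygon `P`. -/
structure RowMatches (n : ℕ) (z : FriezeIndex → ℂ) (P : ℤ → QPoint K) (i : ℤ) : Prop where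
  node : ∀ j, i ≤ j → j ≤ i + n → z (.node i j) = dist (P i) (P j)
  halfSnd : ∀ j, i ≤ j → j + 1 ≤ i + n → z (.halfSnd i j) = area (P i) (P j) (P (j + 1))

/-- The fan at the vertex `k` closes up to a polygon with `n` vertices, because the entries on the
upper boundary of the frieze repeat those on the lines (`IsFrieze.node_top`). -/
theorem exists_polygon (hz : IsFrieze K n z) (hn : 4 ≤ n) (hv : NonVanishing K n z) (k : ℤ) :
    ∃ P : ℤ → QPoint K, (∀ i, P (i + n) = P i) ∧
      (∀ j, z (.lineSE j) = dist (P j) (P (j + 1))) ∧ RowMatches n z P k := by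
  obtain ⟨V, hV1, hV2, hV3⟩ := exists_fan hz hn hv k
  have hn0 : (0 : ℤ) < n := by omega
  let P : ℤ → QPoint K := fun i => V ((i - k) % n).toNat
  have hP : ∀ i, P (i + n) = P i := by
    intro i
    simp only [P]
    rw [show i + (n : ℤ) - k = i - k + n by ring, Int.add_emod_right]
  have hPV : ∀ s : ℕ, s < n → P (k + s) = V s := by
    intro s hs
    simp only [P]
    rw [add_sub_cancel_left, Int.emod_eq_of_lt (by omega) (by omega), Int.toNat_natCast]
  have hP0 : P k = V 0 := by simpa using hPV 0 (by omega)
  have hPn : P (k + n) = V 0 := by rw [hP, hP0]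
  have hline : ∀ s : ℕ, s < n → z (.lineSE (k + s)) = dist (P (k + s)) (P (k + s + 1)) := by
    intro s hs
    rcases Nat.lt_or_ge (s + 1) n with h | h
    · have := hPV (s + 1) h
      push_cast at this
      rw [← hV3 s h, hPV s hs, add_assoc, this]
    · obtain rfl : n = s + 1 := by omega
      have h1 := (hz.node_top (by omega) k).1
      rw [Nat.cast_add, Nat.cast_one] at h1 hPn
      rw [show k + ((s : ℤ) + 1) - 1 = k + s by ring] at h1
      rw [← h1, ← hV1 s hs, add_assoc, hPn, hPV s hs, QPoint.dist_comm]
  refine ⟨P, hP, fun j => ?_, fun j h1 h2 => ?_, fun j h1 h2 => ?_⟩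
  · have hz' : Function.Periodic (fun i => z (.lineSE i)) (n : ℤ) := hz.lineSE_add (by omega)
    have hd' : Function.Periodic (fun i => dist (P i) (P (i + 1))) (n : ℤ) := by
      intro i
      simp only
      rw [hP, show i + (n : ℤ) + 1 = i + 1 + n by ring, hP]
    have e1 := hz'.sub_int_mul_eq ((j - k) / n) (x := j)
    have e2 := hd'.sub_int_mul_eq ((j - k) / n) (x := j)
    have h1 := Int.emod_nonneg (j - k) hn0.ne'
    have h2 := Int.emod_lt_of_pos (j - k) hn0
    have h3 := Int.emod_add_mul_ediv (j - k) n
    obtain ⟨s, hs⟩ := Int.eq_ofNat_of_zero_le h1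
    have h4 : j - ((j - k) / n : ℤ) * (n : ℤ) = k + s := by
      rw [mul_comm]; omega
    simp only [Int.cast_id, h4] at e1 e2
    rw [← e1, ← e2]
    exact hline s (by omega)
  · obtain ⟨s, hs⟩ := Int.eq_ofNat_of_zero_le (sub_nonneg.mpr h1)
    obtain rfl : j = k + s := by omega
    rcases Nat.lt_or_ge s n with h | h
    · rw [hP0, hPV s h, hV1 s h]
    · obtain rfl : s = n := by omega
      rw [hP, QPoint.dist_self, hz.top_node]
  · obtain ⟨s, hs⟩ := Int.eq_ofNat_of_zero_le (sub_nonneg.mpr h1)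
    obtain rfl : j = k + s := by omega
    rcases Nat.lt_or_ge (s + 1) n with h | h
    · have := hPV (s + 1) h
      push_cast at this
      rw [hP0, hPV s (by omega), add_assoc, this, hV2 s h]
    · obtain rfl : n = s + 1 := by omega
      have h1 := hz.top_halfSnd k
      rw [Nat.cast_add, Nat.cast_one] at h1 hPn
      rw [show k + ((s : ℤ) + 1) - 1 = k + s by ring] at h1
      rw [h1, add_assoc, hPn, hP0, area_self_outer]

/-- The row `i` of a frieze determines the row `i + 1`. -/
theorem rowMatches_succ (hz : IsFrieze K n z) (hn : 4 ≤ n) (hv : NonVanishing K n z)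
    {P : ℤ → QPoint K} (hP : ∀ i, P (i + n) = P i)
    (hL : ∀ j, z (.lineSE j) = dist (P j) (P (j + 1))) {i : ℤ} (hi : RowMatches n z P i) :
    RowMatches n z P (i + 1) ∧
      ∀ j, i + 1 ≤ j → j ≤ i + n → z (.halfFst i j) = area (P i) (P (i + 1)) (P j) := by
  have hb := hz.node_succ (by omega) i
  have ht := hz.node_top (by omega) i
  have hN := hz.lineNE_eq (by omega) i
  -- Each diamond with `2 ≤ j - i ≤ n - 2` carries the match one step further along the row.
  have step : ∀ j, 2 ≤ j - i → j - i ≤ n - 2 →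
      z (.node (i + 1) j) = dist (P (i + 1)) (P j) →
      z (.halfFst i j) = area (P i) (P (i + 1)) (P j) →
      z (.node (i + 1) (j + 1)) = dist (P (i + 1)) (P (j + 1)) ∧
      z (.halfFst i (j + 1)) = area (P i) (P (i + 1)) (P (j + 1)) ∧
      z (.halfSnd (i + 1) j) = area (P (i + 1)) (P j) (P (j + 1)) := by
    intro j h1 h2 h3 h4
    have hd := hz.diamond i j (by omega) (by omega)
    obtain ⟨h0, h4'⟩ := hv i j h1 h2
    rw [hi.node j (by omega) (by omega)] at h0 h4'
    rw [hi.node j (by omega) (by omega), hi.node (j + 1) (by omega) (by omega),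
      hi.halfSnd j (by omega) (by omega), hN, hL, hL, h3, h4] at hd
    exact eq_of_isHeronianDiamond _ _ _ _ hd h0 h4'
  have base : z (.node (i + 1) (i + 2)) = dist (P (i + 1)) (P (i + 2)) ∧
      z (.halfFst i (i + 2)) = area (P i) (P (i + 1)) (P (i + 2)) := by
    have e : i + 1 + 1 = i + 2 := by ring
    have := hi.halfSnd (i + 1) (by omega) (by omega)
    have hL' := hL (i + 1)
    rw [e] at hb this hL'
    exact ⟨hb.2.1.trans hL', hb.2.2.trans this⟩
  have main : ∀ s : ℕ, s + 3 ≤ n →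
      z (.node (i + 1) (i + 2 + s)) = dist (P (i + 1)) (P (i + 2 + s)) ∧
      z (.halfFst i (i + 2 + s)) = area (P i) (P (i + 1)) (P (i + 2 + s)) := by
    intro s
    induction s with
    | zero => simpa using fun _ => base
    | succ s ih =>
      intro h
      obtain ⟨h1, h2⟩ := ih (by omega)
      obtain ⟨h3, h4, -⟩ := step _ (by omega) (by omega) h1 h2
      rw [Nat.cast_add, Nat.cast_one, ← add_assoc]
      exact ⟨h3, h4⟩
  have main' : ∀ j, 2 ≤ j - i → j - i ≤ n - 1 →
      z (.node (i + 1) j) = dist (P (i + 1)) (P j) ∧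
      z (.halfFst i j) = area (P i) (P (i + 1)) (P j) := by
    intro j h1 h2
    obtain ⟨s, hs⟩ := Int.eq_ofNat_of_zero_le (sub_nonneg.mpr h1)
    obtain rfl : j = i + 2 + s := by omega
    exact main s (by omega)
  have hfst : ∀ j, i + 1 ≤ j → j ≤ i + n →
      z (.halfFst i j) = area (P i) (P (i + 1)) (P j) := by
    intro j h1 h2
    rcases eq_or_lt_of_le h1 with rfl | h1'
    · rw [hz.bottom_halfFst, area_self_right]
    rcases eq_or_lt_of_le h2 with rfl | h2'
    · rw [hz.top_halfFst, hP, area_self_outer]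
    exact (main' j (by omega) (by omega)).2
  refine ⟨⟨fun j h1 h2 => ?_, fun j h1 h2 => ?_⟩, hfst⟩
  · rcases eq_or_lt_of_le h1 with rfl | h1'
    · rw [hz.bottom_node, QPoint.dist_self]
    rcases eq_or_lt_of_le h2 with rfl | h2'
    · rw [hz.top_node, hP, QPoint.dist_self]
    rcases eq_or_ne j (i + n) with rfl | h3
    · rw [ht.2.1, hN, hL, hP, QPoint.dist_comm]
    exact (main' j (by omega) (by omega)).1
  · rcases eq_or_lt_of_le h1 with rfl | h1'
    · rw [hz.bottom_halfSnd, area_self]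
    rcases eq_or_ne j (i + n) with rfl | h3
    · have := hz.top_halfSnd (i + 1)
      rw [show i + 1 + (n : ℤ) - 1 = i + n by ring] at this
      rw [this, show i + (n : ℤ) + 1 = i + 1 + n by ring, hP, hP, area_self_outer]
    rcases eq_or_ne j (i + n - 1) with rfl | h4
    · rw [ht.2.2, hfst _ (by omega) (by omega), sub_add_cancel, hP, ← area_rotate]
    · obtain ⟨e1, e2⟩ := main' j (by omega) (by omega)
      exact (step j (by omega) (by omega) e1 e2).2.2

/-- The points of the frieze with first coordinate at least `k`, and all lines. -/
def rightOf (k : ℤ) : Set FriezeIndex := fun α =>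
  match α with
  | .node i _ => k ≤ i
  | .halfFst i _ => k ≤ i
  | .halfSnd i _ => k ≤ i
  | .lineNE _ => True
  | .lineSE _ => True

/-- A nonvanishing frieze is measured from a polygon at all points with first coordinate at
least `k`. -/
theorem exists_polygon_measure_eq (hz : IsFrieze K n z) (hn : 4 ≤ n) (hv : NonVanishing K n z)
    (k : ℤ) : ∃ P : ℤ → QPoint K, (∀ i, P (i + n) = P i) ∧
      ∀ α ∈ indexSet n, α ∈ rightOf k → z α = measure P α := by
  obtain ⟨P, hP, hL, hk⟩ := exists_polygon hz hn hv k
  have hrow : ∀ i, k ≤ i → RowMatches n z P i := fun i hi =>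
    Int.leInduction hk (fun _ _ h => (rowMatches_succ hz hn hv hP hL h).1) i hi
  refine ⟨P, hP, fun α hα hk => ?_⟩
  cases α with
  | node i j => exact (hrow i hk).node j hα.1 hα.2
  | halfFst i j => exact (rowMatches_succ hz hn hv hP hL (hrow i hk)).2 j hα.1 hα.2
  | halfSnd i j => exact (hrow i hk).halfSnd j hα.1 hα.2
  | lineNE i => exact (hz.lineNE_eq (by omega) i).trans (hL i)
  | lineSE j => exact hL j

end Propagation

/-! ### Polygons on the sphere -/

section Sphere

variable {K : ℂ} {n : ℕ} {z : FriezeIndex → ℂ}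

/-- The sphere of radius `R` and the model surface for `K = 1 / R²` are identified by
`u = x₀`, `v = -x₁`, `t = R (x₂ + R)`; the sign makes orientations agree. -/
theorem exists_polygon_of_arisesFromPolygon (h : ArisesFromPolygon K n z) :
    ∃ P : ℤ → QPoint K, (∀ i, P (i + n) = P i) ∧ ∀ α ∈ indexSet n, z α = measure P α := by
  obtain ⟨R, A, hR, rfl, hA, hz⟩ := h
  have hA' : ∀ m, A m 0 ^ 2 + A m 1 ^ 2 + A m 2 ^ 2 = R ^ 2 := by
    intro m
    rw [← hA m, dotProduct, Fin.sum_univ_three]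
    ring
  let Q : ZMod n → QPoint (1 / R ^ 2) := fun m =>
    ⟨A m 0, -A m 1, R * (A m 2 + R), by
      field_simp
      linear_combination hA' m⟩
  have hdist : ∀ m m', sqDist (A m) (A m') = dist (Q m) (Q m') := by
    intro m m'
    simp only [sqDist, dotProduct, Fin.sum_univ_three, QPoint.dist, Q, Pi.sub_apply]
    field_simp
    linear_combination hA' m + hA' m'
  have harea : ∀ m m' m'', triS R (A m) (A m') (A m'') = area (Q m) (Q m') (Q m'') := by
    intro m m' m''
    simp only [triS, Matrix.det_fin_three, area, Q]
    simp
    field_simp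
    ring
  refine ⟨fun i => Q i, fun i => by simp, fun α hα => ?_⟩
  rw [hz α hα]
  cases α <;> simp only [polygonFrieze, measure, hdist, harea]

end Sphere

/-! ### Indices on a traversing path -/

section PathIndex

variable {n : ℕ}

theorem fst_last_le (π : TraversingPath n) {t : ℕ} (ht : t + 1 < n) :
    π.fst (n - 2) ≤ π.fst t := by
  obtain ⟨m, hm⟩ : ∃ m, n - 2 = t + m := Nat.exists_eq_add_of_le (by omega)
  have key : ∀ m, t + m + 1 < n → π.fst (t + m) ≤ π.fst t := by
    intro m
    induction m with
    | zero => exact fun _ => le_rfl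
    | succ m ih =>
      intro h
      have := ih (by omega)
      rcases π.step (t + m) (by omega) with ⟨h1, _⟩ | ⟨h1, _⟩ <;>
        rw [← add_assoc, h1] <;> omega
  rw [hm]
  exact key m (by omega)

theorem index_mem (π : TraversingPath n) (u : Pos n) :
    π.index u ∈ indexSet n ∧ π.index u ∈ rightOf (π.fst (n - 2)) := by
  rcases u with ⟨t, ht⟩ | ⟨t, ht⟩ | ⟨t, ht⟩
  · have h1 := π.snd_sub_fst t (by omega)
    have h2 := fst_last_le π (t := t) (by omega)
    exact ⟨⟨by simp only; omega, by simp only; omega⟩, h2⟩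
  · have h1 := π.snd_sub_fst t (by omega)
    have h2 := fst_last_le π (t := t) (by omega)
    have h3 := fst_last_le π (t := t + 1) (by omega)
    have h4 := π.step t (by omega)
    simp only [index, half]
    split_ifs with h
    · exact ⟨⟨by omega, by omega⟩, h2⟩
    · exact ⟨⟨by omega, by omega⟩, h3⟩
  · simp only [index, line]
    split_ifs <;> exact ⟨trivial, trivial⟩

theorem rightOf_mono {k l : ℤ} (h : k ≤ l) : rightOf l ⊆ rightOf k := by
  intro α hα
  cases α with
  | node | halfFst | halfSnd => exact h.trans hα
  | lineNE | lineSE => trivial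

theorem exists_mem_rightOf (α : FriezeIndex) : ∃ k, α ∈ rightOf k := by
  cases α with
  | node i _ | halfFst i _ | halfSnd i _ => exact ⟨i, le_refl i⟩
  | lineNE | lineSE => exact ⟨0, trivial⟩

end PathIndex

end SphericalFrieze

open SphericalFrieze in
theorem mainTheorem2 (K : ℂ) (n : ℕ) (hn : 4 ≤ n) (π : TraversingPath n)
    (α : FriezeIndex) (hα : α ∈ indexSet n) :
    ∃ (N : MvPolynomial (TraversingPath.Pos n) ℂ) (m : Fin (n - 1) → ℕ),
      ∀ z : FriezeIndex → ℂ, IsFrieze K n z →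
        (∀ t ∈ π.diagonals, π.denomFactor K z t ≠ 0) →
        (NonVanishing K n z ∨ ArisesFromPolygon K n z) →
        z α = MvPolynomial.eval (π.initialData z) N /
          ∏ t ∈ π.diagonals, π.denomFactor K z t ^ m t := by
  obtain ⟨N, m, h⟩ :=
    exists_eval_div_of_mem_laurentAlgebra π (measure_mem_laurentAlgebra K π hn α)
  refine ⟨N, m, fun z hz hD hc => ?_⟩
  obtain ⟨P, hP, hα', hu⟩ : ∃ P : ℤ → QPoint K, (∀ i, P (i + n) = P i) ∧ z α = measure P α ∧
      ∀ u, π.initialData z u = π.initialData (measure P) u := by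
    rcases hc with hc | hc
    · -- The fan is taken at a vertex to the left of the path and of `α`.
      obtain ⟨k, hk⟩ := exists_mem_rightOf α
      obtain ⟨P, hP, h⟩ := exists_polygon_measure_eq hz hn hc (min k (π.fst (n - 2)))
      exact ⟨P, hP, h α hα (rightOf_mono (min_le_left _ _) hk), fun u =>
        h _ (index_mem π u).1 (rightOf_mono (min_le_right _ _) (index_mem π u).2)⟩
    · obtain ⟨P, hP, h⟩ := exists_polygon_of_arisesFromPolygon hc
      exact ⟨P, hP, h α hα, fun u => h _ (index_mem π u).1⟩
  have hu' : π.initialData z = π.initialData (measure P) := funext hu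
  have hd : ∀ t, π.denomFactor K z t = π.denomFactor K (measure P) t := fun t => by
    simp only [TraversingPath.denomFactor, hu']
  simp only [hd] at hD ⊢
  rw [hα', hu']
  exact h ⟨P, hP, hD⟩
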